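/- Let $b \ge 2$ be an integer. A finite linearly ordered $b$-uniform hypergraph is a structure $\mathcal{A} = (A, E, <)$ where $A$ is a nonempty finite set (of vertices), $E$ is a set of $b$-element subsets of $A$ (the hyperedges), and $<$ is a linear order on $A$. An embedding of $\mathcal{A} = (A, E, <)$ into $\mathcal{B} = (B, F, <)$ is an injective map $f : A \to B$ such that $x < y \iff f(x) < f(y)$ for all $x, y \in A$, and $e \in E \iff f(e) \in F$ for every $b$-element subset $e$ of $A$. Let $\mathbf{H}(b)$ be the category whose objects are the finite linearly ordered $b$-uniform hypergraphs and whose morphisms are the embeddings, with the usual composition of maps. A category $\mathbf{C}$ has the Ramsey property if for every integer $k \ge 2$ and all objects $A, B$ of $\mathbf{C}$ with $\hom_{\mathbf{C}}(A, B) \ne \varnothing$ there is an object $C$ of $\mathbf{C}$ such that for every colouring $\chi : \hom_{\mathbf{C}}(A, C) \to \{1, \ldots, k\}$ there are a colour $i \in \{1, \ldots, k\}$ and a morphism $w \in \hom_{\mathbf{C}}(B, C)$ with $\chi(w \cdot f) = i$ for all $f \in \hom_{\mathbf{C}}(A, B)$. Theorem. For every integer $b \ge 2$ the category $\mathbf{H}(b)$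 has the Ramsey property. -/

import Mathlib

open CategoryTheory

universe u

section RamseyProperty

variable {𝒞 : Type*} [Category 𝒞]

/-- `C ⟶ (B)^A_k`: for every `k`-colouring of `hom(A, C)` there are a colour `i` and a morphism
`w : B ⟶ C` such that all composites `w · f`, with `f ∈ hom(A, B)`, have colour `i`. -/
def RamseyArrow (C B A : 𝒞) (k : ℕ) : Prop :=
  ∀ χ : (A ⟶ C) → Fin k, ∃ (i : Fin k) (w : B ⟶ C), ∀ f : A ⟶ B, χ (f ≫ w) = i

/-- The Ramsey property of a category. -/
def HasRamseyProperty (𝒞 : Type*) [Category 𝒞] : Prop :=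
  ∀ k : ℕ, 2 ≤ k → ∀ A B : 𝒞, Nonempty (A ⟶ B) → ∃ C : 𝒞, RamseyArrow C B A k

end RamseyProperty

/-- A finite linearly ordered `b`-uniform hypergraph `(A, E, <)`: a nonempty finite set of
vertices with a linear order and a set of hyperedges, each of which has exactly `b` vertices. -/
structure OrdHypergraph (b : ℕ) : Type (u + 1) where
  /-- the set of vertices -/
  V : Type u
  [nonempty : Nonempty V]
  [finite : Finite V]
  [linearOrder : LinearOrder V]
  /-- the set of hyperedges -/
  E : Set (Finset V)
  card_eq : ∀ e ∈ E, e.card = b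

namespace OrdHypergraph

attribute [instance] OrdHypergraph.nonempty OrdHypergraph.finite OrdHypergraph.linearOrder

variable {b : ℕ}

/-- Embeddings: injections of the vertices which preserve and reflect the linear order and the
hyperedges. -/
@[ext]
structure Hom (A B : OrdHypergraph.{u} b) : Type u where
  /-- the map on vertices; an `OrderEmbedding` is injective with `f x ≤ f y ↔ x ≤ y` -/
  toEmb : A.V ↪o B.V
  edge_iff : ∀ e : Finset A.V, e.card = b → (e ∈ A.E ↔ e.map toEmb.toEmbedding ∈ B.E)

/-- The identity embedding. -/
def Hom.id (A : OrdHypergraph.{u} b) : Hom A A where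
  toEmb := RelEmbedding.refl _
  edge_iff e _ := by
    have h : e.map (RelEmbedding.refl ((· ≤ ·) : A.V → A.V → Prop)).toEmbedding = e := by
      ext x
      simp
    rw [h]

/-- Composition of embeddings: first `f`, then `g`. -/
def Hom.comp {A B C : OrdHypergraph.{u} b} (f : Hom A B) (g : Hom B C) : Hom A C where
  toEmb := f.toEmb.trans g.toEmb
  edge_iff e he := by
    rw [f.edge_iff e he, g.edge_iff _ (by simpa using he), Finset.map_map]
    rfl

/-- The category `H(b)` of finite linearly ordered `b`-uniform hypergraphs and embeddings. -/
instance : Category (OrdHypergraph.{u} b) where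
  Hom := Hom
  id := Hom.id
  comp := Hom.comp

end OrdHypergraph

/-!
The proof is the partite construction of Nešetřil and Rödl, based on the Hales–Jewett theorem.

Fix `A`, `B` and the number `k` of colours. By the finite Ramsey theorem
(`exists_orderEmbedding_homogeneous`) there is a finite linear order `I` such that for every
`k`-colouring of the order embeddings `A ↪o I` some `τ : B ↪o I` makes all `f ≫ τ` the same colour.
Consider hypergraphs partitioned into parts indexed by `I`, all of whose edges are transversal
(`PartiteSystem`). It suffices to find such a system `Q` so that every colouring of
the transversal copies of `A` in `Q` admits, over each `τ : B ↪o I`, a copy of `B` within which the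
colour of a copy of `A` depends only on its projection `A ↪o I`; the Ramsey theorem for `I` then
finishes the proof. Ordering `Q` first by parts, and arbitrarily within each part, makes all
transversal copies over order embeddings into embeddings of ordered hypergraphs.

The system `Q` is built from the disjoint union of copies of `B`, one for each `τ : B ↪o I`
(`PartiteSystem.copies`), by treating the projections `σ : A ↪o I` one at a time. One such step
(`PartiteSystem.power`) replaces `P` by a power of `P`, where the dimension `ι` comes from the
Hales–Jewett theorem for the alphabet of all copies of `A` in `P` over `σ`. Words over this
alphabet are copies of `A` in the power, and combinatorial lines yield embeddings of `P` into the
power (`PartiteSystem.lineHom`). A monochromatic line thus gives an embedded `P` in which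
all copies of `A` over `σ` have the same colour.
-/

/-! ### The finite Ramsey theorem -/

/-- The finite Ramsey theorem for colourings of the `a`-element subsets of a linear order. -/
theorem exists_finset_homogeneous (k a n : ℕ) : ∃ N : ℕ, ∀ (I : Type) [LinearOrder I]
    (c : Finset I → Fin k) (S : Finset I), N ≤ S.card →
      ∃ H ⊆ S, H.card = n ∧ ∃ i, ∀ T ⊆ H, T.card = a → c T = i := by
  induction a generalizing n with
  | zero =>
    refine ⟨n, fun I _ c S hS => ?_⟩
    obtain ⟨H, hHS, hH⟩ := Finset.exists_subset_card_eq hS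
    refine ⟨H, hHS, hH, c ∅, fun T _ hT => ?_⟩
    rw [Finset.card_eq_zero.mp hT]
  | succ a ih =>
    -- First find a large `H` on which the colour of an `(a + 1)`-set depends only on its minimum.
    have key : ∀ m : ℕ, ∃ N : ℕ, ∀ (I : Type) [LinearOrder I] (c : Finset I → Fin k)
        (S : Finset I), N ≤ S.card → ∃ H ⊆ S, H.card = m ∧ ∃ d : I → Fin k, ∀ x ∈ H,
          ∀ T ⊆ H, (∀ y ∈ T, x < y) → T.card = a → c (insert x T) = d x := by
      intro m
      induction m with
      | zero =>
        exact ⟨0, fun I _ c S _ => ⟨∅, by simp, rfl, fun _ => c ∅, by simp⟩⟩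
      | succ m ihm =>
        obtain ⟨M, hM⟩ := ihm
        obtain ⟨N, hN⟩ := ih M
        refine ⟨N + 1, fun I _ c S hS => ?_⟩
        have hne : S.Nonempty := Finset.card_pos.mp (by omega)
        set x := S.min' hne with hx
        have hxS : x ∈ S := S.min'_mem hne
        obtain ⟨S', hS', hcard, i, hi⟩ := hN I (fun T => c (insert x T)) (S.erase x)
          (by rw [Finset.card_erase_of_mem hxS]; omega)
        obtain ⟨H, hH, hHm, d, hd⟩ := hM I c S' hcard.ge
        have hlt : ∀ y ∈ H, x < y := fun y hy => by
          have := hS' (hH hy)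
          exact lt_of_le_of_ne (S.min'_le y (Finset.mem_of_mem_erase this))
            (Finset.ne_of_mem_erase this).symm
        have hxH : x ∉ H := fun h => lt_irrefl _ (hlt x h)
        refine ⟨insert x H, ?_, by rw [Finset.card_insert_of_notMem hxH, hHm],
          Function.update d x i, ?_⟩
        · intro y hy
          rcases Finset.mem_insert.mp hy with rfl | hy
          · exact hxS
          · exact Finset.mem_of_mem_erase (hS' (hH hy))
        · intro y hy T hT hyT hTa
          have hxT : x ∉ T := fun h => by
            have h1 := hyT x h
            rcases Finset.mem_insert.mp hy with rfl | hy
            · exact lt_irrefl _ h1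
            · exact lt_asymm h1 (hlt y hy)
          have hTH : T ⊆ H := (Finset.subset_insert_iff_of_notMem hxT).mp hT
          rcases Finset.mem_insert.mp hy with rfl | hyH
          · rw [Function.update_self]
            exact hi T (hTH.trans hH) hTa
          · rw [Function.update_of_ne (hlt y hyH).ne']
            exact hd y hyH T hTH hyT hTa
    obtain ⟨N, hN⟩ := key (k * n)
    refine ⟨N, fun I _ c S hS => ?_⟩
    obtain ⟨H, hHS, hH, d, hd⟩ := hN I c S hS
    have : Nonempty (Fin k) := ⟨c ∅⟩
    -- By the pigeonhole principle, the minimum may be assumed irrelevant too.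
    obtain ⟨i, -, hi⟩ := Finset.exists_le_card_fiber_of_mul_le_card_of_maps_to
      (s := H) (t := Finset.univ) (f := d) (n := n) (fun _ _ => Finset.mem_univ _)
      Finset.univ_nonempty (by simp [hH])
    obtain ⟨H', hH', hcard⟩ := Finset.exists_subset_card_eq hi
    have hH'H : H' ⊆ H := hH'.trans (Finset.filter_subset _ _)
    refine ⟨H', hH'H.trans hHS, hcard, i, fun T hT hTa => ?_⟩
    have hne : T.Nonempty := Finset.card_pos.mp (by omega)
    have hmem := T.min'_mem hne
    have h := hd (T.min' hne) (hH'H (hT hmem)) (T.erase (T.min' hne))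
      ((Finset.erase_subset _ _).trans (hT.trans hH'H))
      (fun y hy => T.min'_lt_of_mem_erase_min' hne hy)
      (by rw [Finset.card_erase_of_mem hmem]; omega)
    rw [Finset.insert_erase hmem] at h
    rw [h]
    exact (Finset.mem_filter.mp (hH' (hT hmem))).2

/-- The finite Ramsey theorem for order embeddings of finite linear orders. -/
theorem exists_orderEmbedding_homogeneous (k : ℕ) [Nonempty (Fin k)] (V W : Type*)
    [LinearOrder V] [LinearOrder W] [Finite V] [Finite W] :
    ∃ N : ℕ, ∀ c : (V ↪o Fin N) → Fin k, ∃ (τ : W ↪o Fin N) (i : Fin k),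
      ∀ f : V ↪o W, c (f.trans τ) = i := by
  classical
  have := Fintype.ofFinite V
  have := Fintype.ofFinite W
  obtain ⟨N, hN⟩ := exists_finset_homogeneous k (Fintype.card V) (Fintype.card W)
  refine ⟨N, fun c => ?_⟩
  obtain ⟨H, -, hH, i, hi⟩ := hN (Fin N)
    (fun T => if h : ∃ σ : V ↪o Fin N, Set.range σ = T then c h.choose else Classical.arbitrary _)
    Finset.univ (by simp)
  let τ : W ↪o Fin N :=
    (Fintype.orderIsoFinOfCardEq W rfl).symm.toOrderEmbedding.trans (H.orderEmbOfFin hH)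
  refine ⟨τ, i, fun f => ?_⟩
  have hT : Set.range (f.trans τ) =
      ((Finset.univ.map (f.trans τ).toEmbedding : Finset (Fin N)) : Set (Fin N)) := by
    simp
  have h := hi (Finset.univ.map (f.trans τ).toEmbedding) (fun y hy => by
    obtain ⟨x, -, rfl⟩ := Finset.mem_map.mp hy
    exact H.orderEmbOfFin_mem hH _) (by simp)
  have hex : ∃ σ : V ↪o Fin N, Set.range σ =
      ((Finset.univ.map (f.trans τ).toEmbedding : Finset (Fin N)) : Set (Fin N)) := ⟨_, hT⟩
  rw [dif_pos hex] at h
  rw [← h]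
  congr 1
  exact (OrderEmbedding.range_inj.mp (hex.choose_spec.trans hT.symm)).symm

/-! ### Partite systems -/

/-- An `I`-partite hypergraph: a finite set of vertices with a projection to the index set `I`,
whose fibres are the parts, and a set of transversal edges (of any size). -/
structure PartiteSystem (I : Type) : Type (u + 1) where
  /-- the set of vertices -/
  X : Type u
  [finite : Finite X]
  /-- the part a vertex belongs to -/
  p : X → I
  /-- the set of edges -/
  E : Set (Set X)
  injOn : ∀ e ∈ E, Set.InjOn p e

namespace PartiteSystem

attribute [instance] PartiteSystem.finite

variable {I : Type} {b : ℕ}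

/-- Embeddings of partite systems: injections that preserve the parts, and preserve and reflect
the edges. -/
structure Hom (P Q : PartiteSystem.{u} I) where
  /-- the map on vertices -/
  toFun : P.X → Q.X
  inj : Function.Injective toFun
  proj : ∀ x, Q.p (toFun x) = P.p x
  edge_iff : ∀ e, e ∈ P.E ↔ toFun '' e ∈ Q.E

/-- The composite of `v : P → Q` and `w : Q → R`. -/
def Hom.comp {P Q R : PartiteSystem.{u} I} (v : P.Hom Q) (w : Q.Hom R) : P.Hom R where
  toFun := w.toFun ∘ v.toFun
  inj := w.inj.comp v.inj
  proj x := (w.proj _).trans (v.proj x)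
  edge_iff e := by rw [v.edge_iff, w.edge_iff, Set.image_comp]

theorem some_pair_injective (P : PartiteSystem.{u} I) :
    Function.Injective (fun v : P.X => (P.p v, some v)) := fun x y h => by
  simpa using congrArg Prod.snd h

/-- The `i`-th coordinates of the vertices in `e` exist, lie in the correct parts, and form an
edge of `P`. -/
def EdgeAt (P : PartiteSystem.{u} I) {ι : Type} (i : ι) (e : Set (I × (ι → Option P.X))) : Prop :=
  ∃ e' ∈ P.E, (fun v => (P.p v, some v)) '' e' = (fun z => (z.1, z.2 i)) '' e

theorem edgeAt_iff {P : PartiteSystem.{u} I} {ι : Type} {i : ι}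
    {e : Set (I × (ι → Option P.X))} {e' : Set P.X}
    (h : (fun z => (z.1, z.2 i)) '' e = (fun v => (P.p v, some v)) '' e') :
    P.EdgeAt i e ↔ e' ∈ P.E := by
  constructor
  · rintro ⟨e'', he'', h'⟩
    rwa [← (some_pair_injective P).image_injective (h'.trans h)]
  · exact fun he' => ⟨e', he', h.symm⟩

variable [LinearOrder I]

/-- A transversal copy in `P` of the hypergraph `A`, with `σ` as its projection to `I`. -/
structure Copy (A : OrdHypergraph.{u} b) (P : PartiteSystem.{u} I) (σ : A.V ↪o I) where
  /-- the map on vertices -/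
  toFun : A.V → P.X
  proj : ∀ a, P.p (toFun a) = σ a
  edge_iff : ∀ e : Finset A.V, e ∈ A.E ↔ toFun '' e ∈ P.E

variable {A B : OrdHypergraph.{u} b} {P Q : PartiteSystem.{u} I} {σ : A.V ↪o I}

theorem Copy.toFun_injective : Function.Injective (Copy.toFun : P.Copy A σ → _) := by
  rintro ⟨g, _, _⟩ ⟨g', _, _⟩ h
  cases h
  rfl

instance : Finite (P.Copy A σ) := Finite.of_injective _ Copy.toFun_injective

/-- The image of a copy under an embedding of partite systems. -/
def Copy.map (g : P.Copy A σ) (w : P.Hom Q) : Q.Copy A σ where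
  toFun := w.toFun ∘ g.toFun
  proj a := (w.proj _).trans (g.proj a)
  edge_iff e := by rw [g.edge_iff, w.edge_iff, Set.image_comp]

/-- The restriction of a copy of `B` along an embedding of `A` into `B`. -/
def Copy.restrict (f : A ⟶ B) {τ : B.V ↪o I} (h : P.Copy B τ) :
    P.Copy A (f.toEmb.trans τ) where
  toFun := h.toFun ∘ f.toEmb
  proj a := h.proj _
  edge_iff e := by
    -- Sets of any size occur here, while `f` is only known to respect edges among the `b`-sets.
    have he : e ∈ A.E ↔ e.map f.toEmb.toEmbedding ∈ B.E := by
      by_cases hb : e.card = b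
      · exact f.edge_iff e hb
      · exact iff_of_false (fun h => hb (A.card_eq _ h))
          (fun h => hb (by simpa using B.card_eq _ h))
    rw [he, h.edge_iff, Finset.coe_map, Set.image_comp]
    rfl

/-! ### Powers of partite systems and the Hales–Jewett theorem -/

/-- The power of `P` with coordinates indexed by `ι`, relative to a projection `σ : A ↪o I`.
A vertex of the part `s` is a word in `Option P.X`; the letter `none` serves as a filler outside of
the range of `σ`. A transversal set that lies over an edge of `A` is an edge if all of its
coordinates are edges of `P`; any other transversal set is an edge if one of its coordinates is. -/
abbrev power (P : PartiteSystem.{u} I) (A : OrdHypergraph.{u} b) (σ : A.V ↪o I) (ι : Type)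
    [Finite I] [Finite ι] : PartiteSystem.{u} I where
  X := I × (ι → Option P.X)
  p := Prod.fst
  E := {e | Set.InjOn Prod.fst e ∧
    ((∃ t ∈ A.E, σ '' t = Prod.fst '' e) → ∀ i, P.EdgeAt i e) ∧
    ((¬ ∃ t ∈ A.E, σ '' t = Prod.fst '' e) → ∃ i, P.EdgeAt i e)}
  injOn _ he := he.1

variable {ι : Type}

open Classical in
/-- The map from the vertices of `P` to those of `P.power A σ ι` given by a combinatorial line over
the alphabet of copies of `A`. At an active coordinate it is the identity; at a fixed coordinate
with letter `g` it sends the part over `σ a` to the vertex `a` of the copy `g`, and all parts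
outside the range of `σ` to `none`. -/
noncomputable def lineMap (L : Combinatorics.Line (P.Copy A σ) ι) (v : P.X) :
    I × (ι → Option P.X) :=
  (P.p v, fun i => (L.idxFun i).elim (some v) fun g =>
    if h : ∃ a, σ a = P.p v then some (g.toFun h.choose) else none)

theorem lineMap_active (L : Combinatorics.Line (P.Copy A σ) ι) {i : ι} (hi : L.idxFun i = none)
    (v : P.X) : (lineMap L v).2 i = some v := by
  simp [lineMap, hi]

theorem lineMap_fixed (L : Combinatorics.Line (P.Copy A σ) ι) {i : ι} {g : P.Copy A σ}
    (hi : L.idxFun i = some g) {v : P.X} {a : A.V} (ha : σ a = P.p v) :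
    (lineMap L v).2 i = some (g.toFun a) := by
  have h : ∃ a, σ a = P.p v := ⟨a, ha⟩
  have : h.choose = a := σ.injective (h.choose_spec.trans ha.symm)
  simp only [lineMap, hi, Option.elim, dif_pos h, this]

theorem exists_of_lineMap_fixed (L : Combinatorics.Line (P.Copy A σ) ι) {i : ι} {g : P.Copy A σ}
    (hi : L.idxFun i = some g) {v x : P.X} (hv : (lineMap L v).2 i = some x) :
    ∃ a, σ a = P.p v := by
  by_contra h
  simp [lineMap, hi, dif_neg h] at hv

theorem edgeAt_lineMap_active (L : Combinatorics.Line (P.Copy A σ) ι) {i : ι}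
    (hi : L.idxFun i = none) (e : Set P.X) : P.EdgeAt i (lineMap L '' e) ↔ e ∈ P.E := by
  apply edgeAt_iff
  rw [Set.image_image]
  simp only [lineMap_active L hi]
  rfl

/-- At a fixed coordinate, the image of `e` is an edge exactly if `e` lies over an edge of `A`: the
letter there is a copy of `A`, and it is filled up with `none` outside of the range of `σ`. -/
theorem edgeAt_lineMap_fixed (L : Combinatorics.Line (P.Copy A σ) ι) {i : ι} {g : P.Copy A σ}
    (hi : L.idxFun i = some g) (e : Set P.X) :
    P.EdgeAt i (lineMap L '' e) ↔ ∃ t ∈ A.E, σ '' t = P.p '' e := by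
  -- Over a set `t` of vertices of `A`, the `i`-th coordinates form the set `g '' t`.
  have key : ∀ t : Finset A.V, σ '' t = P.p '' e → (P.EdgeAt i (lineMap L '' e) ↔ t ∈ A.E) := by
    intro t ht
    rw [g.edge_iff]
    apply edgeAt_iff
    rw [Set.image_image, Set.image_image]
    ext z
    constructor
    · rintro ⟨v, hv, rfl⟩
      obtain ⟨a, ha, hav⟩ : P.p v ∈ σ '' t := ht ▸ Set.mem_image_of_mem _ hv
      refine ⟨a, ha, ?_⟩
      simp only [lineMap_fixed L hi hav, g.proj]
      rw [hav]
      rfl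
    · rintro ⟨a, ha, rfl⟩
      obtain ⟨v, hv, hav⟩ : σ a ∈ P.p '' e := ht ▸ Set.mem_image_of_mem _ ha
      refine ⟨v, hv, ?_⟩
      simp only [lineMap_fixed L hi hav.symm, g.proj]
      rw [← hav]
      rfl
  constructor
  · intro h
    obtain ⟨e', -, he'⟩ := id h
    have hr : ∀ v ∈ e, ∃ a, σ a = P.p v := by
      intro v hv
      obtain ⟨x, -, hx⟩ : ((lineMap L v).1, (lineMap L v).2 i) ∈
          (fun v => (P.p v, some v)) '' e' :=
        he' ▸ Set.mem_image_of_mem _ (Set.mem_image_of_mem _ hv)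
      exact exists_of_lineMap_fixed L hi (congrArg Prod.snd hx).symm
    have ht : σ '' ((Set.toFinite {a | σ a ∈ P.p '' e}).toFinset : Set A.V) = P.p '' e := by
      ext s
      simp only [Set.Finite.coe_toFinset, Set.mem_image, Set.mem_ofPred_eq]
      constructor
      · rintro ⟨a, ha, rfl⟩
        exact ha
      · rintro ⟨v, hv, rfl⟩
        obtain ⟨a, ha⟩ := hr v hv
        exact ⟨a, ⟨v, hv, ha.symm⟩, ha⟩
    exact ⟨_, (key _ ht).mp h, ht⟩
  · rintro ⟨t, ht, hte⟩
    exact (key t hte).mpr ht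

variable [Finite I] [Finite ι]

/-- A word of copies of `A` in `P` is a copy of `A` in the power of `P`. -/
def wordCopy (G : ι → P.Copy A σ) : (P.power A σ ι).Copy A σ where
  toFun a := (σ a, fun i => some ((G i).toFun a))
  proj _ := rfl
  edge_iff t := by
    have hE : ∀ i, P.EdgeAt i
        ((fun a => (σ a, fun i => some ((G i).toFun a))) '' (t : Set A.V)) ↔ t ∈ A.E := by
      intro i
      rw [(G i).edge_iff]
      apply edgeAt_iff
      rw [Set.image_image, Set.image_image]
      simp only [(G i).proj]
    have hfst : Prod.fst ''
        ((fun a => (σ a, fun i => some ((G i).toFun a))) '' (t : Set A.V)) = σ '' t := by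
      rw [Set.image_image]
    have hiff : (∃ t' ∈ A.E, σ '' t' = σ '' t) ↔ t ∈ A.E := by
      constructor
      · rintro ⟨t', ht', h⟩
        rwa [← Finset.coe_injective (σ.injective.image_injective h)]
      · exact fun h => ⟨t, h, rfl⟩
    change _ ↔ Set.InjOn _ _ ∧ _ ∧ _
    rw [hfst, hiff]
    simp only [hE]
    refine ⟨fun h => ⟨?_, fun _ _ => h, fun h' => absurd h h'⟩, fun h => ?_⟩
    · rintro _ ⟨x, -, rfl⟩ _ ⟨y, -, rfl⟩ hxy
      rw [σ.injective hxy]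
    · by_contra h'
      obtain ⟨_, h''⟩ := h.2.2 h'
      exact h' h''

/-- A combinatorial line over the alphabet of copies of `A` over `σ` embeds `P` into its power. -/
noncomputable def lineHom (L : Combinatorics.Line (P.Copy A σ) ι) : P.Hom (P.power A σ ι) where
  toFun := lineMap L
  inj v v' h := by
    obtain ⟨i, hi⟩ := L.proper
    have := congrArg (fun z => z.2 i) h
    simpa [lineMap_active L hi] using this
  proj _ := rfl
  edge_iff e := by
    obtain ⟨i₀, hi₀⟩ := L.proper
    have hfst : Prod.fst '' (lineMap L '' e) = P.p '' e := by
      rw [Set.image_image]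
      rfl
    change _ ↔ Set.InjOn _ _ ∧ _ ∧ _
    rw [hfst]
    constructor
    · intro he
      refine ⟨?_, fun ht i => ?_, fun _ => ⟨i₀, (edgeAt_lineMap_active L hi₀ e).mpr he⟩⟩
      · rintro _ ⟨x, hx, rfl⟩ _ ⟨y, hy, rfl⟩ hxy
        rw [P.injOn e he hx hy hxy]
      · cases hi : L.idxFun i with
        | none => exact (edgeAt_lineMap_active L hi e).mpr he
        | some g => exact (edgeAt_lineMap_fixed L hi e).mpr ht
    · rintro ⟨-, h1, h2⟩
      by_cases ht : ∃ t ∈ A.E, σ '' t = P.p '' e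
      · exact (edgeAt_lineMap_active L hi₀ e).mp (h1 ht i₀)
      · obtain ⟨i, h⟩ := h2 ht
        cases hi : L.idxFun i with
        | none => exact (edgeAt_lineMap_active L hi e).mp h
        | some g => exact absurd ((edgeAt_lineMap_fixed L hi e).mp h) ht

theorem map_lineHom (L : Combinatorics.Line (P.Copy A σ) ι) (g : P.Copy A σ) :
    g.map (lineHom L) = wordCopy (L g) := by
  apply Copy.toFun_injective
  funext a
  refine Prod.ext (g.proj a) (funext fun i => ?_)
  change (lineMap L (g.toFun a)).2 i = some ((L g i).toFun a)
  cases hi : L.idxFun i with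
  | none => rw [lineMap_active L hi, L.apply_none _ _ hi]
  | some g' =>
    rw [lineMap_fixed L hi (g.proj a).symm]
    simp [hi]

/-- For a single projection `σ`, colours can be made constant on the copies over `σ`. -/
theorem exists_mono_over (k : ℕ) (P : PartiteSystem.{u} I) (σ : A.V ↪o I) :
    ∃ Q : PartiteSystem.{u} I, ∀ χ : Q.Copy A σ → Fin k,
      ∃ (w : P.Hom Q) (i : Fin k), ∀ g : P.Copy A σ, χ (g.map w) = i := by
  obtain ⟨ι, _, hι⟩ := Combinatorics.Line.exists_mono_in_high_dimension (P.Copy A σ) (Fin k)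
  refine ⟨P.power A σ ι, fun χ => ?_⟩
  obtain ⟨L, i, hi⟩ := hι fun G => χ (wordCopy G)
  exact ⟨lineHom L, i, fun g => by rw [map_lineHom]; exact hi g⟩

/-- Colours can be made to depend only on the projection, for any finite set of projections. -/
theorem exists_mono_over_finset (k : ℕ) (𝒮 : Finset (A.V ↪o I)) (P : PartiteSystem.{u} I) :
    ∃ Q : PartiteSystem.{u} I, ∀ χ : ∀ σ : A.V ↪o I, Q.Copy A σ → Fin k,
      ∃ w : P.Hom Q, ∀ σ ∈ 𝒮, ∃ i : Fin k, ∀ g : P.Copy A σ, χ σ (g.map w) = i := by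
  classical
  induction 𝒮 using Finset.induction_on generalizing P with
  | empty =>
    exact ⟨P, fun _ => ⟨⟨id, Function.injective_id, fun _ => rfl, fun _ => by simp⟩, by simp⟩⟩
  | insert σ 𝒮 _ ih =>
    -- Embedding `R` into `Q` makes colours constant over each member of `𝒮`, and this persists for
    -- the copies that lie in an embedded `P`.
    obtain ⟨R, hR⟩ := exists_mono_over k P σ
    obtain ⟨Q, hQ⟩ := ih R
    refine ⟨Q, fun χ => ?_⟩
    obtain ⟨w, hw⟩ := hQ χ
    obtain ⟨v, i, hv⟩ := hR fun g => χ σ (g.map w)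
    refine ⟨v.comp w, fun σ' hσ' => ?_⟩
    rcases Finset.mem_insert.mp hσ' with rfl | hσ'
    · exact ⟨i, hv⟩
    · obtain ⟨j, hj⟩ := hw σ' hσ'
      exact ⟨j, fun g => hj (g.map v)⟩

/-! ### The Ramsey property -/

/-- The disjoint union of copies of `B`, one over each `τ : B ↪o I`. -/
abbrev copies (B : OrdHypergraph.{u} b) (I : Type) [LinearOrder I] [Finite I] :
    PartiteSystem.{u} I where
  X := (B.V ↪o I) × B.V
  finite := by
    have := DFunLike.finite (B.V ↪o I)
    infer_instance
  p x := x.1 x.2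
  E := {e | ∃ τ : B.V ↪o I, ∃ t ∈ B.E, e = Prod.mk τ '' t}
  injOn := by
    rintro _ ⟨τ, t, -, rfl⟩ _ ⟨x, -, rfl⟩ _ ⟨y, -, rfl⟩ h
    exact congrArg (Prod.mk τ) (τ.injective h)

/-- The copy of `B` over `τ` in the disjoint union `copies B I`. -/
def copiesMk (τ : B.V ↪o I) : (copies B I).Copy B τ where
  toFun x := (τ, x)
  proj _ := rfl
  edge_iff t := by
    constructor
    · exact fun ht => ⟨τ, t, ht, rfl⟩
    · rintro ⟨τ', t', ht', h⟩
      have h2 := congrArg (Set.image Prod.snd) h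
      simp only [Set.image_image, Set.image_id'] at h2
      rwa [Finset.coe_injective h2]

/-- A nonempty partite system as an ordered `b`-uniform hypergraph: the vertices are ordered by
parts, and arbitrarily within each part; only the edges with `b` elements are kept. -/
noncomputable def toOrdHypergraph (Q : PartiteSystem.{u} I) (b : ℕ) (hQ : Nonempty Q.X) :
    OrdHypergraph.{u} b where
  V := Q.X
  linearOrder := LinearOrder.lift' (fun x => toLex (Q.p x, Finite.equivFin Q.X x))
    fun _ _ h => (Finite.equivFin Q.X).injective (congrArg (fun z => (ofLex z).2) h)
  E := {e | (e : Set Q.X) ∈ Q.E ∧ e.card = b}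
  card_eq _ he := he.2

/-- A copy over an order embedding is an embedding of ordered hypergraphs. -/
noncomputable def Copy.toHom {hQ : Nonempty Q.X} (g : Q.Copy A σ) :
    A ⟶ Q.toOrdHypergraph b hQ :=
  let φ : A.V ↪o (Q.toOrdHypergraph b hQ).V :=
    OrderEmbedding.ofStrictMono g.toFun fun x y hxy => Prod.Lex.toLex_lt_toLex.mpr <| Or.inl <| by
      simpa only [g.proj] using σ.strictMono hxy
  OrdHypergraph.Hom.mk φ fun e he => (g.edge_iff e).trans <| by
    have h : (e.map φ.toEmbedding : Set (Q.toOrdHypergraph b hQ).V) = g.toFun '' e :=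
      Finset.coe_map φ.toEmbedding e
    rw [← h]
    exact ⟨fun h' => ⟨h', (Finset.card_map _).trans he⟩, fun h' => h'.1⟩

end PartiteSystem

open PartiteSystem in
theorem mainTheorem2 (b : ℕ) (hb : 2 ≤ b) : HasRamseyProperty (OrdHypergraph.{u} b) := by
  intro k hk A B _
  have : Nonempty (Fin k) := ⟨⟨0, by omega⟩⟩
  obtain ⟨N, hN⟩ := exists_orderEmbedding_homogeneous k A.V B.V
  have := DFunLike.finite (A.V ↪o Fin N)
  have := Fintype.ofFinite (A.V ↪o Fin N)
  obtain ⟨Q, hQ⟩ := exists_mono_over_finset k Finset.univ (copies B (Fin N)) (A := A)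
  have hne : Nonempty Q.X := by
    obtain ⟨τ, -⟩ := hN (fun _ => Classical.arbitrary _)
    obtain ⟨w, -⟩ := hQ fun _ _ => Classical.arbitrary _
    exact ⟨w.toFun (τ, Classical.arbitrary _)⟩
  refine ⟨Q.toOrdHypergraph b hne, fun χ => ?_⟩
  obtain ⟨w, hw⟩ := hQ fun _ g => χ g.toHom
  choose c hc using fun σ => hw σ (Finset.mem_univ σ)
  obtain ⟨τ, i, hτ⟩ := hN c
  refine ⟨i, ((copiesMk τ).map w).toHom, fun f => ?_⟩
  rw [← hτ f.toEmb, ← hc _ ((copiesMk τ).restrict f)]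
  exact congrArg χ (OrdHypergraph.Hom.ext rfl)
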